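/- Let $k$ be a field, let $B$ be a finite-dimensional commutative $k$-algebra and let $A \subset B$ be a $k$-subalgebra. Let $I$ and $J$ be the nilradicals of $A$ and $B$, and put $A_{\mathrm{red}} = A/I$ and $B_{\mathrm{red}} = B/J$. Let $\mu^B$ be the unit group scheme of $B$, that is, the algebraic group with $\mu^B(R) = (B \otimes_k R)^{*}$ for every commutative $k$-algebra $R$; define $\mu^A \subset \mu^B$ likewise, and let $\mu^{B/A} = \mu^B/\mu^A$ be the quotient algebraic group (the fppf quotient sheaf). An algebraic group over $k$ is called a torus if over an algebraic closure $\bar{k}$ it becomes isomorphic to $\mathbb{G}_m^n$ for some $n \ge 0$. A finite-dimensional commutative $k$-algebra is called separable if it is étale over $k$. Consider the conditions (i) $\mu^{B/A}$ is a torus; (ii) $I = J$, and $B_{\mathrm{red}}$ is separable over $k$. Then: (a) If $\mu^{B/A}$ is a torus, then $I = J$. (b) (ii) implies (i), and (ii) also implies that $A_{\mathrm{red}}$ is separable over $k$. (c) If every ideal of $B$ that is contained in $A$ is nilpotent (equivalently, $A \subset B$ have no nonzero direct factor in common), then (i) and (ii) are equivalent. -/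

import Mathlib

open CategoryTheory AlgebraicGeometry
open scoped TensorProduct

universe u

namespace RelativeUnits

noncomputable section

/-- The structure morphism `k → Γ(X, 𝒪_X)` of the `k`-algebra of global functions on a
`k`-scheme `X`. -/
def structureHom (k : Type u) [Field k] (X : Over (Spec (.of k))) :
    k →+* Γ(X.left, ⊤) :=
  ((Scheme.ΓSpecIso (.of k)).inv ≫ X.hom.appTop).hom

/-- A morphism of `k`-schemes `X ⟶ Y` induces a homomorphism `Γ(Y, 𝒪_Y) → Γ(X, 𝒪_X)` of rings
that is compatible with the structure morphisms. -/
theorem appTop_structureHom (k : Type u) [Field k] {X Y : Over (Spec (.of k))} (f : X ⟶ Y)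
    (c : k) : f.left.appTop.hom (structureHom k Y c) = structureHom k X c := by
  have h : Y.hom.appTop ≫ f.left.appTop = X.hom.appTop := by
    rw [← Scheme.Hom.comp_appTop, Over.w f]
  simp only [structureHom, ← h]
  rfl

/-- The `k`-algebra `Γ(X, 𝒪_X)` of global functions on a `k`-scheme `X`. -/
def globalAlgebra (k : Type u) [Field k] (X : Over (Spec (.of k))) : CommAlgCat.{u} k :=
  letI := (structureHom k X).toAlgebra
  CommAlgCat.of k Γ(X.left, ⊤)

/-- A morphism `f : X ⟶ Y` of `k`-schemes induces a homomorphism `Γ(Y, 𝒪_Y) → Γ(X, 𝒪_X)` of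
`k`-algebras. -/
def globalAlgebraMap (k : Type u) [Field k] {X Y : Over (Spec (.of k))} (f : X ⟶ Y) :
    globalAlgebra k Y →ₐ[k] globalAlgebra k X where
  toRingHom := f.left.appTop.hom
  commutes' c := appTop_structureHom k f c

/-- The functor that sends a `k`-scheme `X` to the `k`-algebra `Γ(X, 𝒪_X)`. -/
def globalFunctions (k : Type u) [Field k] :
    (Over (Spec (.of k)))ᵒᵖ ⥤ CommAlgCat.{u} k where
  obj X := globalAlgebra k X.unop
  map {X Y} f := CommAlgCat.ofHom (X := globalAlgebra k X.unop) (Y := globalAlgebra k Y.unop)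
    (globalAlgebraMap k f.unop)
  map_id X := by
    refine CommAlgCat.hom_ext (AlgHom.ext fun x => ?_)
    exact congrArg (fun h => h.hom x) (Scheme.Hom.id_appTop (X := X.unop.left))
  map_comp f g := by
    refine CommAlgCat.hom_ext (AlgHom.ext fun x => ?_)
    exact congrArg (fun h => h.hom x) (Scheme.Hom.comp_appTop g.unop.left f.unop.left)

section Quotient

variable {k B : Type u} [Field k] [CommRing B] [Algebra k B] (A : Subalgebra k B)

/-- For a `k`-algebra `R`, the inclusion `μ^A(R) = (A ⊗ R)ˣ → (B ⊗ R)ˣ = μ^B(R)`. -/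
def unitsInclusion (R : Type u) [CommRing R] [Algebra k R] : (A ⊗[k] R)ˣ →* (B ⊗[k] R)ˣ :=
  Units.map (Algebra.TensorProduct.map A.val (AlgHom.id k R)).toRingHom.toMonoidHom

/-- For a homomorphism `R → S` of `k`-algebras, the map `μ^B(R) → μ^B(S)`. -/
def unitsMap (B : Type u) [CommRing B] [Algebra k B] {R S : Type u} [CommRing R] [Algebra k R]
    [CommRing S] [Algebra k S] (φ : R →ₐ[k] S) : (B ⊗[k] R)ˣ →* (B ⊗[k] S)ˣ :=
  Units.map (Algebra.TensorProduct.map (AlgHom.id k B) φ).toRingHom.toMonoidHom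

theorem range_le_comap {R S : Type u} [CommRing R] [Algebra k R]
    [CommRing S] [Algebra k S] (φ : R →ₐ[k] S) :
    (unitsInclusion A R).range ≤ (unitsInclusion A S).range.comap (unitsMap B φ) := by
  rintro _ ⟨x, rfl⟩
  refine ⟨unitsMap A φ x, Units.ext ?_⟩
  have h : (Algebra.TensorProduct.map A.val (AlgHom.id k S)).comp
      (Algebra.TensorProduct.map (AlgHom.id k A) φ) =
      (Algebra.TensorProduct.map (AlgHom.id k B) φ).comp
        (Algebra.TensorProduct.map A.val (AlgHom.id k R)) := by
    ext <;> simp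
  exact DFunLike.congr_fun h (x : A ⊗[k] R)

/-- The functor `R ↦ μ^B(R) / μ^A(R)` from `k`-algebras to abelian groups (before
sheafification). -/
def naiveQuotient : CommAlgCat.{u} k ⥤ AddCommGrpCat.{u} where
  obj R := .of (Additive ((B ⊗[k] R)ˣ ⧸ (unitsInclusion A R).range))
  map {R S} φ := AddCommGrpCat.ofHom
    (QuotientGroup.map (unitsInclusion A R).range (unitsInclusion A S).range
      (unitsMap B φ.hom) (range_le_comap A φ.hom)).toAdditive
  map_id R := by
    refine AddCommGrpCat.hom_ext (AddMonoidHom.ext fun y => ?_)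
    obtain ⟨x, rfl⟩ := QuotientGroup.mk_surjective y.toMul
    refine congrArg (fun y : (B ⊗[k] R)ˣ => Additive.ofMul (QuotientGroup.mk y)) (Units.ext ?_)
    exact DFunLike.congr_fun (Algebra.TensorProduct.map_id (R := k) (S := k) (A := B) (B := R))
      (x : B ⊗[k] R)
  map_comp {R S T} φ ψ := by
    refine AddCommGrpCat.hom_ext (AddMonoidHom.ext fun y => ?_)
    obtain ⟨x, rfl⟩ := QuotientGroup.mk_surjective y.toMul
    refine congrArg (fun y : (B ⊗[k] T)ˣ => Additive.ofMul (QuotientGroup.mk y)) (Units.ext ?_)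
    have h : Algebra.TensorProduct.map (AlgHom.id k B) (ψ.hom.comp φ.hom) =
        (Algebra.TensorProduct.map (AlgHom.id k B) ψ.hom).comp
          (Algebra.TensorProduct.map (AlgHom.id k B) φ.hom) := by
      ext <;> simp
    exact DFunLike.congr_fun h (x : B ⊗[k] R)

/-- The relative unit group `μ^{B/A} = μ^B / μ^A`, as an abelian sheaf on the big fppf site of
`Spec k`: the fppf sheafification of `X ↦ (B ⊗ Γ(X, 𝒪_X))ˣ / (A ⊗ Γ(X, 𝒪_X))ˣ`.
For `B` finite-dimensional this is the quotient of the algebraic group `μ^B` by its closed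
subgroup `μ^A`. The universe lift is there only because the site is large. -/
def relativeUnitGroup :
    Sheaf (Scheme.fppfTopology.{u}.over (Spec (.of k))) AddCommGrpCat.{u + 1} :=
  (presheafToSheaf _ _).obj
    (globalFunctions k ⋙ naiveQuotient A ⋙ AddCommGrpCat.uliftFunctor.{u + 1, u})

end Quotient

/-- The functor `R ↦ (Rˣ)ⁿ` from `K`-algebras to abelian groups. -/
def unitsPower (K : Type u) [Field K] (n : ℕ) : CommAlgCat.{u} K ⥤ AddCommGrpCat.{u} where
  obj R := .of (Fin n → Additive Rˣ)
  map {R S} φ := AddCommGrpCat.ofHom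
    ((Units.map φ.hom.toRingHom.toMonoidHom).toAdditive.compLeft (Fin n))

/-- The split torus `𝔾ₘⁿ` over the field `K`, as a functor on `K`-schemes. -/
def splitTorus (K : Type u) [Field K] (n : ℕ) :
    (Over (Spec (.of K)))ᵒᵖ ⥤ AddCommGrpCat.{u + 1} :=
  globalFunctions K ⋙ unitsPower K n ⋙ AddCommGrpCat.uliftFunctor.{u + 1, u}

/-- A commutative algebraic group `G` over `k` (given by its fppf sheaf of points on
`k`-schemes) is a torus if its base change to the algebraic closure of `k` is isomorphic, as a
group functor on schemes over the algebraic closure, to `𝔾ₘⁿ` for some `n ≥ 0`. -/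
def IsTorus {k : Type u} [Field k]
    (G : Sheaf (Scheme.fppfTopology.{u}.over (Spec (.of k))) AddCommGrpCat.{u + 1}) : Prop :=
  ∃ n : ℕ, Nonempty
    ((Over.map (Spec.map (CommRingCat.ofHom (algebraMap k (AlgebraicClosure k))))).op ⋙ G.obj ≅
      splitTorus (AlgebraicClosure k) n)

end

end RelativeUnits

/-! The common tool is linear: an element of `B ⊗ R` lies in `A ⊗ R` exactly when its contractions
along the functionals on `B` that vanish on `A` are zero (`mem_range_tensorInclusion_iff`).
Vanishing of functions is fppf-local, so the naive quotient is separated and embeds in its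
sheafification (`toRelativeUnitGroup_app_injective`).

(a) Write `K` for the algebraic closure of `k`. If `z` is nilpotent in `B ⊗ K`, then `1 + z X` is a
unit of `B ⊗ K[X]`. It gives a morphism from the affine line to the relative unit group that is
trivial at the origin. Units of `K[X]` are constants, so into a torus this morphism is trivial.
Hence `1 + z X` lies in `A ⊗ K[X]`, and its coefficient `z` in `A ⊗ K`
(`mem_range_of_isNilpotent_of_isTorus`). Taking `z = b ⊗ 1` gives `J ⊆ A`.

(c) The nilpotents of `B ⊗ K` form an ideal contained in `A ⊗ K`, so their coefficients lie in the
conductor of `A` in `B`. If the conductor is nilpotent, they come from `J ⊗ K`; then `B_red ⊗ K` is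
reduced, and `B_red` is étale.

(b) `A_red` embeds in `B_red`, so it is étale too. For a `K`-algebra `R`, the class of a unit of `B
⊗ R` modulo `A ⊗ R` is determined by its values at the characters of `B`, up to functions that
depend only on the restriction to `A`. Fixing one character `r χ` in each restriction class, the
ratios of the values at `χ` and `r χ`, for `χ ≠ r χ`, identify the quotient with a power of `𝔾ₘ`
(`exists_ratioHom`). So over `K` the naive quotient is already a sheaf and agrees with the relative
unit group. -/

namespace RelativeUnits

/-! ### Testing membership in `W ⊗ R` by functionals -/

section LinearAlgebra

variable {k V : Type*} [Field k] [AddCommGroup V] [Module k V]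

/-- The contraction `V ⊗ R → R`, `v ⊗ r ↦ l v • r`, along a linear functional `l` on `V`. -/
noncomputable def contract (R : Type*) [AddCommGroup R] [Module k R] (l : V →ₗ[k] k) :
    V ⊗[k] R →ₗ[k] R :=
  TensorProduct.lift ((LinearMap.lsmul k R).comp l)

@[simp]
theorem contract_tmul {R : Type*} [AddCommGroup R] [Module k R] (l : V →ₗ[k] k) (v : V) (r : R) :
    contract R l (v ⊗ₜ[k] r) = l v • r := rfl

theorem contract_lTensor {R S : Type*} [AddCommGroup R] [Module k R] [AddCommGroup S] [Module k S]
    (l : V →ₗ[k] k) (f : R →ₗ[k] S) (z : V ⊗[k] R) :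
    contract S l (f.lTensor V z) = f (contract R l z) := by
  induction z with
  | zero => simp
  | add x y hx hy => simp [hx, hy]
  | tmul v r => simp

theorem contract_rTensor {V' R : Type*} [AddCommGroup V'] [Module k V'] [AddCommGroup R]
    [Module k R] (l : V →ₗ[k] k) (f : V' →ₗ[k] V) (z : V' ⊗[k] R) :
    contract R l (f.rTensor R z) = contract R (l.comp f) z := by
  induction z with
  | zero => simp
  | add x y hx hy => simp [hx, hy]
  | tmul v r => simp

/-- In a basis of `V`, the coordinates of `z` are its contractions along the coordinate functionals.
-/
theorem eq_zero_of_contract_eq_zero {R : Type*} [AddCommGroup R] [Module k R] {z : V ⊗[k] R}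
    (h : ∀ l : V →ₗ[k] k, contract R l z = 0) : z = 0 := by
  classical
  let b := Module.Basis.ofVectorSpace k V
  refine (TensorProduct.equivFinsuppOfBasisLeft (N := R) b).map_eq_zero_iff.mp
    (Finsupp.ext fun i => ?_)
  refine Eq.trans ?_ (h (b.coord i))
  clear h
  induction z with
  | zero => simp
  | add x y hx hy => simp [hx, hy]
  | tmul v r => simp

/-- An element of `V ⊗ R` lies in `W ⊗ R` if and only if its contractions along all linear
functionals that vanish on `W` are zero. -/
theorem mem_range_rTensor_iff {R : Type*} [AddCommGroup R] [Module k R] (W : Submodule k V)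
    (z : V ⊗[k] R) :
    z ∈ LinearMap.range (W.subtype.rTensor R) ↔
      ∀ l : V →ₗ[k] k, (∀ w ∈ W, l w = 0) → contract R l z = 0 := by
  constructor
  · rintro ⟨y, rfl⟩ l hl
    rw [contract_rTensor, show l.comp W.subtype = 0 from LinearMap.ext fun w => hl w w.2]
    exact DFunLike.congr_fun (show contract R (0 : W →ₗ[k] k) = 0 by ext; simp) y
  · intro h
    have hex := rTensor_exact R (f := W.subtype) (g := W.mkQ)
      (LinearMap.exact_subtype_mkQ W) W.mkQ_surjective
    refine (hex z).mp (eq_zero_of_contract_eq_zero fun l => ?_)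
    rw [contract_rTensor]
    exact h _ fun w hw => by
      rw [LinearMap.comp_apply, Submodule.mkQ_apply, (Submodule.Quotient.mk_eq_zero W).mpr hw,
        map_zero]

end LinearAlgebra

/-! ### The subalgebra `A ⊗ R` of `B ⊗ R` -/

section Subalgebra

variable {k B : Type*} [Field k] [CommRing B] [Algebra k B] (A : Subalgebra k B)

/-- The inclusion `A ⊗ R → B ⊗ R`. -/
noncomputable abbrev tensorInclusion (R : Type*) [CommRing R] [Algebra k R] :
    A ⊗[k] R →ₐ[k] B ⊗[k] R :=
  Algebra.TensorProduct.map A.val (AlgHom.id k R)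

theorem tensorInclusion_injective (R : Type*) [CommRing R] [Algebra k R] :
    Function.Injective (tensorInclusion A R) :=
  Module.Flat.rTensor_preserves_injective_linearMap (M := R) A.val.toLinearMap
    Subtype.val_injective

theorem mem_range_tensorInclusion_iff {R : Type*} [CommRing R] [Algebra k R] (z : B ⊗[k] R) :
    z ∈ (tensorInclusion A R).range ↔
      ∀ l : B →ₗ[k] k, (∀ a ∈ A, l a = 0) → contract R l z = 0 :=
  mem_range_rTensor_iff (Subalgebra.toSubmodule A) z

theorem tmul_one_mem_range_iff {R : Type*} [CommRing R] [Algebra k R] [Nontrivial R] (x : B) :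
    x ⊗ₜ[k] (1 : R) ∈ (tensorInclusion A R).range ↔ x ∈ A := by
  refine ⟨fun h => ?_, fun h => ⟨⟨x, h⟩ ⊗ₜ 1, by simp⟩⟩
  by_contra hx
  obtain ⟨l, hl, hA⟩ := Submodule.exists_le_ker_of_notMem (p := Subalgebra.toSubmodule A) hx
  have := (mem_range_tensorInclusion_iff A _).mp h l fun a ha => hA ha
  simp [hl] at this

/-- If `z` is in `B ⊗ K` and `1 + z X` is in `A ⊗ K[X]`, then `z` is in `A ⊗ K`. -/
theorem mem_range_of_one_add_mul_X {K : Type*} [Field K] [Algebra k K] (z : B ⊗[k] K)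
    (h : 1 + Algebra.TensorProduct.map (AlgHom.id k B) (Polynomial.CAlgHom (R := k) (A := K)) z *
      (1 : B) ⊗ₜ[k] (Polynomial.X : Polynomial K) ∈ (tensorInclusion A (Polynomial K)).range) :
    z ∈ (tensorInclusion A K).range := by
  rw [mem_range_tensorInclusion_iff] at h ⊢
  intro l hl
  -- Contraction commutes with taking the coefficient of `X`, which is `0` for the summand `1` and
  -- `z` for the other.
  have h1 := congrArg ((Polynomial.lcoeff K 1).restrictScalars k) (h l hl)
  rw [map_zero, ← contract_lTensor] at h1
  rw [← h1]
  congr 1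
  rw [map_add, Algebra.TensorProduct.one_def, LinearMap.lTensor_tmul]
  have : (Polynomial.lcoeff K 1).restrictScalars k 1 = 0 := by simp [Polynomial.coeff_one]
  rw [this, TensorProduct.tmul_zero, zero_add]
  clear h h1 this
  induction z with
  | zero => simp
  | add x y hx hy => rw [map_add, add_mul, map_add, ← hx, ← hy]
  | tmul v r => simp

end Subalgebra

/-! ### Nilpotents after base change, and étale algebras -/

section Nilradical

variable {k B : Type*} [Field k] [CommRing B] [Algebra k B]

theorem isNilpotent_of_mem_range_rTensor {R : Type*} [CommRing R] [Algebra k R] {z : B ⊗[k] R}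
    (hz : z ∈ LinearMap.range (((nilradical B).restrictScalars k).subtype.rTensor R)) :
    IsNilpotent z := by
  obtain ⟨y, rfl⟩ := hz
  induction y with
  | zero => simp
  | add x y hx hy => rw [map_add]; exact Commute.isNilpotent_add (Commute.all _ _) hx hy
  | tmul b r =>
    have hb : IsNilpotent (b : B) := b.2
    obtain ⟨n, hn⟩ := hb
    exact ⟨n, by simp [Algebra.TensorProduct.tmul_pow, hn]⟩

/-- The conductor of `A` in `B`: the largest ideal of `B` that is contained in `A`. -/
def conductorIdeal (A : Subalgebra k B) : Ideal B where
  carrier := {b | ∀ c, b * c ∈ A}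
  zero_mem' c := by simp
  add_mem' ha hb c := by rw [add_mul]; exact A.add_mem (ha c) (hb c)
  smul_mem' c b hb d := by
    rw [smul_eq_mul, mul_comm c b, mul_assoc]
    exact hb _

theorem conductorIdeal_subset (A : Subalgebra k B) : (conductorIdeal A : Set B) ⊆ A :=
  fun b hb => by simpa using hb 1

/-- If all nilpotents of `B ⊗ K` are in `A ⊗ K`, and if the conductor of `A` in `B` is nilpotent,
then the nilpotents of `B ⊗ K` come from those of `B`. -/
theorem mem_range_nilradical_of_isNilpotent (A : Subalgebra k B) {K : Type*} [Field K]
    [Algebra k K] (hA : ∀ z : B ⊗[k] K, IsNilpotent z → z ∈ (tensorInclusion A K).range)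
    (hc : conductorIdeal A ≤ nilradical B) {z : B ⊗[k] K} (hz : IsNilpotent z) :
    z ∈ LinearMap.range (((nilradical B).restrictScalars k).subtype.rTensor K) := by
  let c (m : K →ₗ[k] k) : B ⊗[k] K →ₗ[k] B :=
    TensorProduct.rid k B ∘ₗ m.lTensor B
  have hcontract (l : B →ₗ[k] k) (m : K →ₗ[k] k) (w : B ⊗[k] K) :
      m (contract K l w) = l (c m w) := by
    induction w with
    | zero => simp
    | add x y hx hy => simp [hx, hy]
    | tmul v r => simp [c, mul_comm]
  have hmul (m : K →ₗ[k] k) (w : B ⊗[k] K) (b : B) : c m (w * b ⊗ₜ 1) = c m w * b := by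
    induction w with
    | zero => simp
    | add x y hx hy => rw [add_mul, map_add, map_add, add_mul, hx, hy]
    | tmul v r => simp [c]
  have key (m : K →ₗ[k] k) : c m z ∈ nilradical B := by
    -- The nilpotents form an ideal, so `z * (b ⊗ 1)` is again in `A ⊗ K`; its coefficient along `m`
    -- is `c m z * b`, which puts `c m z` in the conductor.
    refine hc fun b => ?_
    have hzb := (mem_range_tensorInclusion_iff A _).mp
      (hA (z * b ⊗ₜ 1) ((Commute.all _ _).isNilpotent_mul_right hz))
    rw [← hmul]
    by_contra hx
    obtain ⟨l, hl, hlA⟩ := Submodule.exists_le_ker_of_notMem (p := Subalgebra.toSubmodule A) hx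
    exact hl (by rw [← hcontract, hzb l fun a ha => hlA ha, map_zero])
  rw [mem_range_rTensor_iff]
  intro l hl
  refine (Module.forall_dual_apply_eq_zero_iff k _).mp fun m => ?_
  rw [hcontract, hl _ (key m)]

/-- If the nilpotents of `B ⊗ K` come from those of `B`, then `B_red ⊗ K` is reduced. -/
theorem isReduced_tensorProduct_quotient {K : Type*} [Field K] [Algebra k K]
    (h : ∀ z : B ⊗[k] K, IsNilpotent z →
      z ∈ LinearMap.range (((nilradical B).restrictScalars k).subtype.rTensor K)) :
    IsReduced (K ⊗[k] (B ⧸ nilradical B)) := by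
  have : IsReduced ((B ⧸ nilradical B) ⊗[k] K) := by
    refine ⟨fun w hw => ?_⟩
    have hex := rTensor_exact K (f := ((nilradical B).restrictScalars k).subtype)
      (g := ((nilradical B).restrictScalars k).mkQ)
      (LinearMap.exact_subtype_mkQ _) (Submodule.mkQ_surjective _)
    let q : B ⊗[k] K →ₐ[k] (B ⧸ nilradical B) ⊗[k] K :=
      Algebra.TensorProduct.map (Ideal.Quotient.mkₐ k _) (AlgHom.id k K)
    have hq : Function.Surjective q := TensorProduct.map_surjective
      (Ideal.Quotient.mkₐ_surjective k _) Function.surjective_id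
    obtain ⟨z, rfl⟩ := hq w
    obtain ⟨n, hn⟩ := hw
    rw [← map_pow] at hn
    -- The kernel of `q` is the image of `J ⊗ K`, which consists of nilpotents.
    have h1 : IsNilpotent (z ^ n) := isNilpotent_of_mem_range_rTensor ((hex _).mp hn)
    exact (hex z).mpr (h z (IsNilpotent.of_pow h1))
  exact isReduced_of_injective (Algebra.TensorProduct.comm k K (B ⧸ nilradical B))
    (Algebra.TensorProduct.comm k K (B ⧸ nilradical B)).injective

/-- A reduced Artinian ring is the product of its residue fields, and these are finite, hence
separable, over `K`. -/
theorem etale_of_isReduced_of_isAlgClosed (K : Type u) (C : Type u) [Field K] [IsAlgClosed K]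
    [CommRing C] [Algebra K C] [Module.Finite K C] [IsReduced C] : Algebra.Etale K C := by
  have : IsArtinianRing C := isArtinian_of_tower K inferInstance
  let _ (m : MaximalSpectrum C) : Field (C ⧸ m.asIdeal) := Ideal.Quotient.field m.asIdeal
  refine (Algebra.Etale.iff_exists_algEquiv_prod K C).mpr ⟨MaximalSpectrum C, inferInstance,
    fun m => C ⧸ m.asIdeal, fun m => inferInstance, fun m => inferInstance,
    (IsArtinianRing.equivPi C).restrictScalars K, fun m => ⟨?_, ?_⟩⟩
  all_goals infer_instance

/-- The converse descends étaleness along the faithfully flat extension from `k` to its algebraic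
closure. -/
theorem etale_iff_isReduced (k : Type u) (C : Type u) [Field k]
    [CommRing C] [Algebra k C] [Module.Finite k C] :
    Algebra.Etale k C ↔ IsReduced (AlgebraicClosure k ⊗[k] C) := by
  constructor
  · intro h
    exact Algebra.FormallyUnramified.isReduced_of_field (AlgebraicClosure k) _
  · intro h
    have := etale_of_isReduced_of_isAlgClosed (AlgebraicClosure k) (AlgebraicClosure k ⊗[k] C)
    exact Algebra.Etale.of_etale_tensorProduct_of_faithfullyFlat (AlgebraicClosure k)

/-- For finite algebras, étale means geometrically reduced, a property inherited by subalgebras. -/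
theorem etale_of_injective {k C D : Type u} [Field k] [CommRing C] [Algebra k C]
    [CommRing D] [Algebra k D] [Module.Finite k D] (f : C →ₐ[k] D) (hf : Function.Injective f)
    [h : Algebra.Etale k D] : Algebra.Etale k C := by
  have : Module.Finite k C := Module.Finite.of_injective f.toLinearMap hf
  rw [etale_iff_isReduced, ← Algebra.isGeometricallyReduced_field_iff] at h ⊢
  exact .of_injective f hf

end Nilradical

/-! ### Evaluation at characters -/

section Evaluation

variable {k K C : Type*} [Field k] [Field K] [Algebra k K] [CommRing C] [Algebra k C]

/-- A character `χ : C → K` induces the homomorphism `C ⊗ R → R`, `c ⊗ r ↦ χ c • r`, for every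
`K`-algebra `R`. -/
noncomputable def evalAt (R : Type*) [CommRing R] [Algebra k R] [Algebra K R]
    [IsScalarTower k K R] (χ : C →ₐ[k] K) : C ⊗[k] R →ₐ[k] R :=
  Algebra.TensorProduct.lift ((IsScalarTower.toAlgHom k K R).comp χ) (AlgHom.id k R)
    fun _ _ => Commute.all _ _

variable {R : Type*} [CommRing R] [Algebra k R] [Algebra K R] [IsScalarTower k K R]

@[simp]
theorem evalAt_tmul (χ : C →ₐ[k] K) (c : C) (r : R) :
    evalAt R χ (c ⊗ₜ r) = algebraMap K R (χ c) * r := by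
  simp [evalAt]

theorem evalAt_map {S : Type*} [CommRing S] [Algebra k S] [Algebra K S] [IsScalarTower k K S]
    (χ : C →ₐ[k] K) (φ : R →ₐ[k] S) (hφ : ∀ c : K, φ (algebraMap K R c) = algebraMap K S c)
    (z : C ⊗[k] R) :
    evalAt S χ (Algebra.TensorProduct.map (AlgHom.id k C) φ z) = φ (evalAt R χ z) := by
  induction z with
  | zero => simp
  | add x y hx hy => simp only [map_add, hx, hy]
  | tmul c r => simp [hφ]

theorem evalAt_tensorInclusion (A : Subalgebra k C) (χ : C →ₐ[k] K) (z : A ⊗[k] R) :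
    evalAt R χ (tensorInclusion A R z) = evalAt R (χ.comp A.val) z := by
  induction z with
  | zero => simp
  | add x y hx hy => simp only [map_add, hx, hy]
  | tmul c r => simp

/-- This turns the linear membership test into a condition on the values at characters. -/
theorem contract_eq_sum_evalAt [Fintype (C →ₐ[k] K)] (l : C →ₗ[k] k) (c : (C →ₐ[k] K) → K)
    (h : ∀ b, algebraMap k K (l b) = ∑ χ, c χ * χ b) (z : C ⊗[k] R) :
    contract R l z = ∑ χ, algebraMap K R (c χ) * evalAt R χ z := by
  induction z with
  | zero => simp
  | add x y hx hy => simp only [map_add, hx, hy, mul_add, Finset.sum_add_distrib]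
  | tmul b r =>
    rw [contract_tmul, Algebra.smul_def, IsScalarTower.algebraMap_apply k K R, h, map_sum,
      Finset.sum_mul]
    simp [mul_assoc]

end Evaluation

/-- Every character of a split algebra is a coordinate function. -/
theorem exists_eq_coordinate {K D : Type*} [Field K] [CommRing D] [Algebra K D] {n : ℕ}
    (e : D ≃ₐ[K] (Fin n → K)) (ψ : D →ₐ[K] K) : ∃ i, ∀ x, ψ x = e x i := by
  -- The standard idempotents sum to `1`, so `ψ` cannot kill them all; multiplication by `x` on the
  -- `i`-th one is the scalar `e x i`.
  obtain ⟨i, hi⟩ : ∃ i, ψ (e.symm (Pi.single i 1)) ≠ 0 := by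
    by_contra! h
    have : ψ (e.symm (∑ i, Pi.single i 1)) = 0 := by
      rw [map_sum, map_sum]; exact Finset.sum_eq_zero fun i _ => h i
    rw [Finset.univ_sum_single (fun _ : Fin n => (1 : K))] at this
    exact one_ne_zero (((map_one (ψ.comp e.symm.toAlgHom)).symm.trans this : (1 : K) = 0))
  refine ⟨i, fun x => mul_right_cancel₀ hi ?_⟩
  rw [← map_mul]
  have : x * e.symm (Pi.single i 1) = e x i • e.symm (Pi.single i 1) := by
    apply e.injective
    rw [map_mul, map_smul, e.apply_symm_apply]
    ext j
    by_cases h : j = i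
    · subst h; simp
    · simp [h]
  rw [this, map_smul, smul_eq_mul]

/-! ### Characters of an algebra with étale reduction -/

section Characters

variable {k C : Type u} [Field k] [CommRing C] [Algebra k C]

/-- If `C_red` is étale, then `C` has finitely many characters with values in an algebraically
closed extension `K`; there are orthogonal elements of `C ⊗ K` for them, and all functionals on
`C_red` are combinations of characters. -/
theorem exists_characters [Algebra.Etale k (C ⧸ nilradical C)] (K : Type u) [Field K] [Algebra k K]
    [IsAlgClosed K] :
    ∃ _ : Fintype (C →ₐ[k] K), (∃ E : (C →ₐ[k] K) → C ⊗[k] K,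
        (∀ χ, evalAt K χ (E χ) = 1) ∧ ∀ χ ψ, χ ≠ ψ → evalAt K χ (E ψ) = 0) ∧
      ∀ l : C →ₗ[k] k, (∀ b ∈ nilradical C, l b = 0) →
        ∃ c : (C →ₐ[k] K) → K, ∀ b, algebraMap k K (l b) = ∑ χ, c χ * χ b := by
  obtain ⟨n, ⟨e⟩⟩ := Algebra.IsFiniteSplit.nonempty_algEquiv_fun K (K ⊗[k] (C ⧸ nilradical C))
  let χ (i : Fin n) : C →ₐ[k] K :=
    ((((Pi.evalAlgHom K (fun _ => K) i).comp e.toAlgHom).restrictScalars k).comp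
      Algebra.TensorProduct.includeRight).comp (Ideal.Quotient.mkₐ k _)
  let q : C ⊗[k] K →ₐ[k] K ⊗[k] (C ⧸ nilradical C) :=
    (Algebra.TensorProduct.comm k _ K).toAlgHom.comp
      (Algebra.TensorProduct.map (Ideal.Quotient.mkₐ k _) (AlgHom.id k K))
  have hq : Function.Surjective q := (Algebra.TensorProduct.comm k _ K).surjective.comp
    (TensorProduct.map_surjective (Ideal.Quotient.mkₐ_surjective k _) Function.surjective_id)
  have hχ (i : Fin n) (z : C ⊗[k] K) : evalAt K (χ i) z = e (q z) i := by
    induction z with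
    | zero => simp
    | add x y hx hy => simp only [map_add, hx, hy, Pi.add_apply]
    | tmul c r =>
      have : q (c ⊗ₜ r) = r • (1 : K) ⊗ₜ[k] Ideal.Quotient.mk (nilradical C) c := by
        simp [q, TensorProduct.smul_tmul']
      rw [this, map_smul, evalAt_tmul, mul_comm]
      rfl
  -- A character with values in a field kills nilpotents, so it factors through `C_red`, and its
  -- `K`-linear extension is a coordinate.
  have hsurj : Function.Surjective χ := by
    intro ψ
    let ψ' : C ⧸ nilradical C →ₐ[k] K := Ideal.Quotient.liftₐ _ ψ fun b hb =>
      (IsNilpotent.map (mem_nilradical.mp hb) ψ).eq_zero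
    obtain ⟨i, hi⟩ := exists_eq_coordinate e
      (Algebra.TensorProduct.lift (AlgHom.id K K) ψ' fun _ _ => Commute.all _ _)
    refine ⟨i, AlgHom.ext fun c => ?_⟩
    refine (hi (1 ⊗ₜ Ideal.Quotient.mk _ c)).symm.trans ?_
    simp only [Algebra.TensorProduct.lift_tmul, map_one, one_mul]
    rfl
  -- Lifts of the standard idempotents along `q`; only their values at characters matter, so they
  -- need not be idempotent.
  choose E hE using fun i => hq (e.symm (Pi.single i 1))
  have hEval (i j : Fin n) : evalAt K (χ i) (E j) = (Pi.single j 1 : Fin n → K) i := by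
    rw [hχ, hE, e.apply_symm_apply]
  have hinj : Function.Injective χ := by
    intro i j hij
    by_contra hne
    have := hEval i j
    rw [hij, hEval j j, Pi.single_eq_same, Pi.single_eq_of_ne hne] at this
    exact one_ne_zero this
  let f := Equiv.ofBijective χ ⟨hinj, hsurj⟩
  have hf (i : Fin n) : f i = χ i := rfl
  let _ := Fintype.ofEquiv _ f
  refine ⟨inferInstance, ⟨fun ψ => E (f.symm ψ), fun ψ => ?_, fun ψ ψ' hne => ?_⟩, ?_⟩
  · obtain ⟨i, rfl⟩ := f.surjective ψ
    beta_reduce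
    rw [f.symm_apply_apply, hf, hEval, Pi.single_eq_same]
  · obtain ⟨i, rfl⟩ := f.surjective ψ
    obtain ⟨j, rfl⟩ := f.surjective ψ'
    beta_reduce
    rw [f.symm_apply_apply, hf, hEval, Pi.single_eq_of_ne (ne_of_apply_ne f hne)]
  · intro l hl
    let l' : C ⧸ nilradical C →ₗ[k] k :=
      ((nilradical C).restrictScalars k).liftQ l fun b hb => hl b hb
    let L : K ⊗[k] (C ⧸ nilradical C) →ₗ[K] K :=
      (TensorProduct.AlgebraTensorModule.rid k K K).toLinearMap ∘ₗ l'.baseChange K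
    refine ⟨fun ψ => L (e.symm (Pi.single (f.symm ψ) 1)), fun b => ?_⟩
    have hL : algebraMap k K (l b) = L (1 ⊗ₜ Ideal.Quotient.mk _ b) := by
      have : l' (Ideal.Quotient.mk _ b) = l b := rfl
      simp [L, this, Algebra.algebraMap_eq_smul_one]
    rw [hL, ← f.sum_comp]
    conv_lhs => rw [← e.symm_apply_apply (1 ⊗ₜ Ideal.Quotient.mk _ b),
      pi_eq_sum_univ' (e (1 ⊗ₜ Ideal.Quotient.mk _ b)), map_sum, map_sum]
    refine Finset.sum_congr rfl fun i _ => ?_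
    beta_reduce
    rw [f.symm_apply_apply, map_smul, map_smul, smul_eq_mul, mul_comm]
    rfl

end Characters

/-- The characters of `B` present `(B ⊗ R)ˣ / (A ⊗ R)ˣ`: if `A ⊂ B` have the same nilradical and
étale reductions, then every `R`-valued function on the characters of `B` comes from an element
of `B ⊗ R`, and it comes from `A ⊗ R` if it depends only on the restriction to `A`. -/
theorem exists_idempotent_retraction {k B : Type u} [Field k] [CommRing B] [Algebra k B]
    (A : Subalgebra k B)
    (hA : ∀ b ∈ nilradical B, b ∈ A) [Algebra.Etale k (B ⧸ nilradical B)]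
    [Algebra.Etale k (A ⧸ nilradical A)] (K : Type u) [Field K] [Algebra k K] [IsAlgClosed K] :
    ∃ _ : Fintype (B →ₐ[k] K), ∃ r : (B →ₐ[k] K) → (B →ₐ[k] K),
      (∀ χ, r (r χ) = r χ) ∧ (∀ χ, ∀ a ∈ A, r χ a = χ a) ∧
      ∀ (R : Type u) [CommRing R] [Algebra k R] [Algebra K R] [IsScalarTower k K R],
        (∀ g : (B →ₐ[k] K) → Rˣ, ∃ u : (B ⊗[k] R)ˣ, ∀ χ, evalAt R χ (u : B ⊗[k] R) = g χ) ∧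
        ∀ u : B ⊗[k] R, (∀ χ, evalAt R χ u = evalAt R (r χ) u) →
          u ∈ (tensorInclusion A R).range := by
  classical
  obtain ⟨hB, ⟨E, hE1, hE0⟩, hl⟩ := exists_characters (k := k) (C := B) K
  obtain ⟨hA', ⟨F, hF1, hF0⟩, -⟩ := exists_characters (k := k) (C := A) K
  let res (χ : B →ₐ[k] K) : A →ₐ[k] K := χ.comp A.val
  -- `s` picks one extension to `B` of each character of `A` that has one. As `r χ` depends only on
  -- `res χ`, which `r` preserves, `r` is idempotent.
  let s (ψ : A →ₐ[k] K) (h : ∃ χ, res χ = ψ) : B →ₐ[k] K := h.choose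
  have hs {ψ ψ'} (h : ∃ χ, res χ = ψ) (h' : ∃ χ, res χ = ψ') (e : ψ = ψ') : s ψ h = s ψ' h' := by
    subst e; rfl
  let r (χ : B →ₐ[k] K) : B →ₐ[k] K := s (res χ) ⟨χ, rfl⟩
  have hr (χ) : res (r χ) = res χ := Exists.choose_spec (p := fun χ' => res χ' = res χ) ⟨χ, rfl⟩
  have hinterp {C : Type u} [CommRing C] [Algebra k C] [Fintype (C →ₐ[k] K)]
      (G : (C →ₐ[k] K) → C ⊗[k] K)
      (h1 : ∀ χ, evalAt K χ (G χ) = 1) (h0 : ∀ χ ψ, χ ≠ ψ → evalAt K χ (G ψ) = 0)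
      (R : Type u) [CommRing R] [Algebra k R] [Algebra K R] [IsScalarTower k K R]
      (g : (C →ₐ[k] K) → R) : ∃ z : C ⊗[k] R, ∀ χ, evalAt R χ z = g χ := by
    refine ⟨∑ ψ, Algebra.TensorProduct.map (AlgHom.id k C) (IsScalarTower.toAlgHom k K R) (G ψ) *
      1 ⊗ₜ g ψ, fun χ => ?_⟩
    have (ψ : C →ₐ[k] K) := evalAt_map χ (IsScalarTower.toAlgHom k K R) (fun c => by simp) (G ψ)
    rw [map_sum, Finset.sum_eq_single χ]
    · simp [this, h1]
    · intro ψ _ hne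
      simp [this, h0 χ ψ hne.symm]
    · simp
  refine ⟨hB, r, fun χ => hs _ _ (hr χ), fun χ a ha => DFunLike.congr_fun (hr χ) ⟨a, ha⟩, ?_⟩
  intro R _ _ _ _
  constructor
  · intro g
    obtain ⟨x, hx⟩ := hinterp E hE1 hE0 R fun χ => (g χ : R)
    obtain ⟨y, hy⟩ := hinterp E hE1 hE0 R fun χ => ((g χ)⁻¹ : Rˣ)
    -- `x * y - 1` vanishes at all characters, hence under all functionals that kill `J`, so it lies
    -- in `J ⊗ R`.
    have hnil : IsNilpotent (x * y - 1) := by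
      refine isNilpotent_of_mem_range_rTensor ((mem_range_rTensor_iff _ _).mpr fun l hl0 => ?_)
      obtain ⟨c, hc⟩ := hl l hl0
      rw [contract_eq_sum_evalAt l c hc]
      exact Finset.sum_eq_zero fun χ _ => by simp [hx, hy]
    have hu : IsUnit (x * y) := by simpa using hnil.isUnit_add_one
    exact ⟨(isUnit_of_mul_isUnit_left hu).unit, hx⟩
  · intro u hu
    -- `a` in `A ⊗ R` is built to take the same values as `u` at all characters of `B`. The value
    -- `0` at characters of `A` that do not extend to `B` is never used.
    obtain ⟨a, ha⟩ := hinterp F hF1 hF0 R fun ψ =>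
      if h : ∃ χ, res χ = ψ then evalAt R (s ψ h) u else 0
    rw [mem_range_tensorInclusion_iff]
    intro l hl0
    -- As `J ⊆ A`, a functional that vanishes on `A` kills `J`, so it is a combination of characters
    -- and cannot tell `u` from `a`.
    obtain ⟨c, hc⟩ := hl l fun b hb => hl0 b (hA b hb)
    have h0 := (mem_range_tensorInclusion_iff A _).mp ⟨a, rfl⟩ l hl0
    rw [← h0, contract_eq_sum_evalAt l c hc, contract_eq_sum_evalAt l c hc]
    refine Finset.sum_congr rfl fun χ _ => ?_
    rw [hu]
    congr 1
    exact ((ha (res χ)).trans (dif_pos ⟨χ, rfl⟩)).symm.trans (evalAt_tensorInclusion A χ a).symm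

/-! ### Global functions form an fppf sheaf -/

section Sections

/-- The functor of points of the affine line. -/
def sectionsFunctor : Scheme.{u}ᵒᵖ ⥤ Type u := Scheme.Γ ⋙ forget CommRingCat

/-- Global functions are represented by the affine line over `ℤ`, and the fppf topology is
subcanonical. -/
theorem isSheaf_sectionsFunctor :
    Presheaf.IsSheaf Scheme.fppfTopology.{u} sectionsFunctor.{u} := by
  have e : sectionsFunctor.{u}.RepresentableBy (Spec (.of (MvPolynomial PUnit (ULift.{u} ℤ)))) :=
    { homEquiv := fun {X} => (AffineSpace.toSpecMvPolyIntEquiv PUnit).trans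
        (Equiv.funUnique PUnit _)
      homEquiv_comp := fun f g => rfl }
  have := e.isRepresentable
  rw [isSheaf_iff_isSheaf_of_type]
  exact GrothendieckTopology.Subcanonical.isSheaf_of_isRepresentable _

variable {k : Type u} [Field k]

theorem isSheaf_sections_over :
    Presieve.IsSheaf (Scheme.fppfTopology.{u}.over (Spec (.of k)))
      ((Over.forget _).op ⋙ sectionsFunctor) := by
  rw [← isSheaf_iff_isSheaf_of_type]
  exact (Over.forget _).op_comp_isSheaf_of_isSheaf _ Scheme.fppfTopology.{u} _
    isSheaf_sectionsFunctor

theorem section_ext {X : Over (Spec (.of k))} {S : Sieve X}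
    (hS : S ∈ Scheme.fppfTopology.{u}.over (Spec (.of k)) X) {a b : globalAlgebra k X}
    (h : ∀ ⦃Y : Over (Spec (.of k))⦄ (f : Y ⟶ X), S f →
      globalAlgebraMap k f a = globalAlgebraMap k f b) : a = b :=
  (isSheaf_sections_over.isSeparated S hS).ext fun _ f hf => h f hf

theorem section_glue {X : Over (Spec (.of k))} {S : Sieve X}
    (hS : S ∈ Scheme.fppfTopology.{u}.over (Spec (.of k)) X)
    (x : ∀ ⦃Y : Over (Spec (.of k))⦄ (f : Y ⟶ X), S f → globalAlgebra k Y)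
    (hx : ∀ ⦃Y Z : Over (Spec (.of k))⦄ (f : Y ⟶ X) (g : Z ⟶ Y) (hf : S f),
      globalAlgebraMap k g (x f hf) = x (g ≫ f) (S.downward_closed hf g)) :
    ∃ a : globalAlgebra k X, ∀ ⦃Y : Over (Spec (.of k))⦄ (f : Y ⟶ X) (hf : S f),
      globalAlgebraMap k f a = x f hf := by
  have hc : Presieve.FamilyOfElements.Compatible (P := (Over.forget _).op ⋙ sectionsFunctor)
      (R := S.arrows) (fun Y f hf => x f hf) :=
    (Presieve.compatible_iff_sieveCompatible _).mpr fun Y Z f g hf => (hx f g hf).symm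
  obtain ⟨a, ha, -⟩ := isSheaf_sections_over S hS _ hc
  exact ⟨a, fun Y f hf => ha f hf⟩

end Sections

/-! ### The split torus is an fppf sheaf -/

section Torus

variable (K : Type u) [Field K] (n : ℕ)

variable {K n}

/-- The coordinates of a point of the split torus. -/
def torusCoord {X : Over (Spec (.of K))} (x : (splitTorus K n).obj (.op X)) (i : Fin n) :
    (globalAlgebra K X)ˣ :=
  (x.down i).toMul

theorem torusCoord_map {X Y : Over (Spec (.of K))} (f : Y ⟶ X)
    (x : (splitTorus K n).obj (.op X)) (i : Fin n) :
    (torusCoord ((splitTorus K n).map f.op x) i : globalAlgebra K Y) =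
      globalAlgebraMap K f (torusCoord x i : globalAlgebra K X) := rfl

theorem splitTorus_ext {X : Over (Spec (.of K))} {x y : (splitTorus K n).obj (.op X)}
    (h : ∀ i, (torusCoord x i : globalAlgebra K X) = torusCoord y i) : x = y :=
  ULift.ext _ _ (funext fun i => Additive.toMul.injective (Units.ext (h i)))

variable (K n)

theorem isSheaf_splitTorus :
    Presheaf.IsSheaf (Scheme.fppfTopology.{u}.over (Spec (.of K))) (splitTorus K n) := by
  refine Presheaf.isSheaf_of_isSheaf_comp _ _ (forget AddCommGrpCat.{u + 1}) ?_
  rw [isSheaf_iff_isSheaf_of_type]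
  intro X S hS x hx
  rw [Presieve.compatible_iff_sieveCompatible] at hx
  let y ⦃Y : Over (Spec (.of K))⦄ (f : Y ⟶ X) (hf : S f) : (splitTorus K n).obj (.op Y) := x f hf
  have hy ⦃Y Z : Over (Spec (.of K))⦄ (f : Y ⟶ X) (g : Z ⟶ Y) (hf : S f) :
      (splitTorus K n).map g.op (y f hf) = y (g ≫ f) (S.downward_closed hf g) := (hx f g hf).symm
  have h1 (i : Fin n) := section_glue hS
    (fun Y f hf => (torusCoord (y f hf) i : globalAlgebra K Y)) fun Y Z f g hf => by
      rw [← hy f g hf]; rfl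
  -- The inverses are glued separately; that the two glued functions multiply to `1` is a local
  -- question.
  have h2 (i : Fin n) := section_glue hS
    (fun Y f hf => ((torusCoord (y f hf) i)⁻¹ : (globalAlgebra K Y)ˣ).val) fun Y Z f g hf => by
      rw [← hy f g hf]; rfl
  choose a ha using h1
  choose b hb using h2
  have hab (i : Fin n) : a i * b i = 1 := section_ext hS fun Y f hf => by
    rw [map_mul, ha i f hf, hb i f hf, Units.mul_inv, map_one]
  let t : (splitTorus K n).obj (.op X) :=
    ULift.up fun i => Additive.ofMul
      (⟨a i, b i, hab i, (mul_comm _ _).trans (hab i)⟩ : (globalAlgebra K X)ˣ)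
  refine ⟨t, fun Y f hf => splitTorus_ext fun i => ha i f hf, fun t' ht' => ?_⟩
  refine splitTorus_ext fun i => section_ext hS fun Y f hf => ?_
  have h : (splitTorus K n).map f.op t' = y f hf := ht' f hf
  rw [← torusCoord_map, h]
  exact (ha i f hf).symm

end Torus

/-! ### The naive quotient is separated -/

section Separated

variable {k B : Type u} [Field k] [CommRing B] [Algebra k B] (A : Subalgebra k B)

/-- The presheaf `X ↦ (B ⊗ Γ(X, 𝒪_X))ˣ / (A ⊗ Γ(X, 𝒪_X))ˣ`. -/
noncomputable abbrev quotientPresheaf : (Over (Spec (.of k)))ᵒᵖ ⥤ AddCommGrpCat.{u + 1} :=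
  globalFunctions k ⋙ naiveQuotient A ⋙ AddCommGrpCat.uliftFunctor.{u + 1, u}

/-- The class of a unit of `B ⊗ R` modulo units of `A ⊗ R`. -/
noncomputable def unitClass {X : Over (Spec (.of k))} (u : (B ⊗[k] globalAlgebra k X)ˣ) :
    (quotientPresheaf A).obj (.op X) :=
  ULift.up (Additive.ofMul (QuotientGroup.mk u))

theorem unitClass_surjective {X : Over (Spec (.of k))} (x : (quotientPresheaf A).obj (.op X)) :
    ∃ u, unitClass A u = x := by
  obtain ⟨u, hu⟩ := QuotientGroup.mk_surjective x.down.toMul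
  exact ⟨u, ULift.ext _ _ (congrArg Additive.ofMul hu)⟩

theorem quotientPresheaf_map_unitClass {X Y : Over (Spec (.of k))} (f : Y ⟶ X)
    (u : (B ⊗[k] globalAlgebra k X)ˣ) :
    (quotientPresheaf A).map f.op (unitClass A u) =
      unitClass A (unitsMap B (globalAlgebraMap k f) u) := rfl

theorem unitClass_eq_zero_iff' {X : Over (Spec (.of k))} (u : (B ⊗[k] globalAlgebra k X)ˣ) :
    unitClass A u = 0 ↔ u ∈ (unitsInclusion A (globalAlgebra k X)).range := by
  rw [← QuotientGroup.eq_one_iff]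
  exact ⟨fun h => congrArg (fun x => Additive.toMul (ULift.down x)) h,
    fun h => ULift.ext _ _ (congrArg Additive.ofMul h)⟩

/-- Since `A ⊗ R → B ⊗ R` is injective, the two preimages are inverse to each other. This reduces a
question about units to two linear membership tests. -/
theorem mem_range_unitsInclusion_iff {R : Type u} [CommRing R] [Algebra k R] (u : (B ⊗[k] R)ˣ) :
    u ∈ (unitsInclusion A R).range ↔ (u : B ⊗[k] R) ∈ (tensorInclusion A R).range ∧
      ((u⁻¹ : (B ⊗[k] R)ˣ) : B ⊗[k] R) ∈ (tensorInclusion A R).range := by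
  constructor
  · rintro ⟨v, rfl⟩
    exact ⟨⟨v, rfl⟩, ⟨(v⁻¹ : (A ⊗[k] R)ˣ), rfl⟩⟩
  · rintro ⟨⟨v, hv⟩, ⟨w, hw⟩⟩
    have h : v * w = 1 := tensorInclusion_injective A R <| by
      rw [map_mul, map_one]
      exact (congrArg₂ _ hv hw).trans u.mul_inv
    exact ⟨⟨v, w, h, (mul_comm _ _).trans h⟩, Units.ext hv⟩

theorem unitClass_eq_zero_iff {X : Over (Spec (.of k))} (u : (B ⊗[k] globalAlgebra k X)ˣ) :
    unitClass A u = 0 ↔ (u : B ⊗[k] globalAlgebra k X) ∈ (tensorInclusion A _).range ∧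
      ((u⁻¹ : (B ⊗[k] globalAlgebra k X)ˣ) : B ⊗[k] globalAlgebra k X) ∈
        (tensorInclusion A _).range := by
  rw [unitClass_eq_zero_iff', mem_range_unitsInclusion_iff]

/-- Membership is the vanishing of certain global functions, and this can be checked on a cover. -/
theorem mem_range_tensorInclusion_of_cover {X : Over (Spec (.of k))} {S : Sieve X}
    (hS : S ∈ Scheme.fppfTopology.{u}.over (Spec (.of k)) X) (z : B ⊗[k] globalAlgebra k X)
    (h : ∀ ⦃Y : Over (Spec (.of k))⦄ (f : Y ⟶ X), S f →
      Algebra.TensorProduct.map (AlgHom.id k B) (globalAlgebraMap k f) z ∈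
        (tensorInclusion A (globalAlgebra k Y)).range) :
    z ∈ (tensorInclusion A (globalAlgebra k X)).range := by
  rw [mem_range_tensorInclusion_iff]
  refine fun l hl => section_ext hS fun Y f hf => ?_
  rw [map_zero, ← (mem_range_tensorInclusion_iff A _).mp (h f hf) l hl]
  exact (contract_lTensor l (globalAlgebraMap k f).toLinearMap z).symm

theorem quotientPresheaf_eq_zero_of_cover {X : Over (Spec (.of k))} {S : Sieve X}
    (hS : S ∈ Scheme.fppfTopology.{u}.over (Spec (.of k)) X)
    (x : (quotientPresheaf A).obj (.op X))
    (h : ∀ ⦃Y : Over (Spec (.of k))⦄ (f : Y ⟶ X), S f → (quotientPresheaf A).map f.op x = 0) :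
    x = 0 := by
  obtain ⟨u, rfl⟩ := unitClass_surjective A x
  simp_rw [quotientPresheaf_map_unitClass, unitClass_eq_zero_iff] at h
  rw [unitClass_eq_zero_iff]
  exact ⟨mem_range_tensorInclusion_of_cover A hS _ fun Y f hf => (h f hf).1,
    mem_range_tensorInclusion_of_cover A hS _ fun Y f hf => (h f hf).2⟩

/-- The homomorphism from the naive quotient to the quotient sheaf. -/
noncomputable abbrev toRelativeUnitGroup : quotientPresheaf A ⟶ (relativeUnitGroup A).obj :=
  toSheafify (Scheme.fppfTopology.{u}.over (Spec (.of k))) (quotientPresheaf A)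

instance : Presheaf.IsLocallyInjective (Scheme.fppfTopology.{u}.over (Spec (.of k)))
    (toRelativeUnitGroup A) :=
  inferInstanceAs (Presheaf.IsLocallyInjective _ (toSheafify _ (quotientPresheaf A)))

instance : Presheaf.IsLocallySurjective (Scheme.fppfTopology.{u}.over (Spec (.of k)))
    (toRelativeUnitGroup A) :=
  inferInstanceAs (Presheaf.IsLocallySurjective _ (toSheafify _ (quotientPresheaf A)))

theorem toRelativeUnitGroup_app_injective {X : Over (Spec (.of k))}
    (x : (quotientPresheaf A).obj (.op X)) (h : (toRelativeUnitGroup A).app (.op X) x = 0) :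
    x = 0 := by
  have := Presheaf.equalizerSieve_mem (Scheme.fppfTopology.{u}.over (Spec (.of k)))
    (toRelativeUnitGroup A) x 0 (by rw [h, map_zero])
  refine quotientPresheaf_eq_zero_of_cover A this x fun Y f hf => ?_
  have hf' : (quotientPresheaf A).map f.op x = (quotientPresheaf A).map f.op 0 := hf
  rw [hf', map_zero]

end Separated

/-! ### Schemes over `K` as schemes over `k` -/

section BaseChange

variable (k K : Type u) [Field k] [Field K] [Algebra k K]

/-- The functor from `K`-schemes to `k`-schemes. -/
noncomputable abbrev restrictBase : Over (Spec (.of K)) ⥤ Over (Spec (.of k)) :=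
  Over.map (Spec.map (CommRingCat.ofHom (algebraMap k K)))

theorem structureHom_restrictBase (X : Over (Spec (.of K))) (c : k) :
    structureHom k ((restrictBase k K).obj X) c = structureHom K X (algebraMap k K c) := by
  have h : (Scheme.ΓSpecIso (.of k)).inv ≫
      (X.hom ≫ Spec.map (CommRingCat.ofHom (algebraMap k K))).appTop =
      CommRingCat.ofHom (algebraMap k K) ≫ (Scheme.ΓSpecIso (.of K)).inv ≫ X.hom.appTop := by
    rw [Scheme.Hom.comp_appTop, Scheme.ΓSpecIso_inv_naturality_assoc]
  exact congrArg (fun f => f.hom c) h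

/-- The global functions on a `K`-scheme, viewed as a `k`-scheme, are a `K`-algebra. -/
@[reducible]
noncomputable def algebraRestrictBase (X : Over (Spec (.of K))) :
    Algebra K (globalAlgebra k ((restrictBase k K).obj X)) :=
  inferInstanceAs (Algebra K (globalAlgebra K X))

theorem isScalarTower_restrictBase (X : Over (Spec (.of K))) :
    letI := algebraRestrictBase k K X
    IsScalarTower k K (globalAlgebra k ((restrictBase k K).obj X)) :=
  letI := algebraRestrictBase k K X
  .of_algebraMap_eq (structureHom_restrictBase k K X)

end BaseChange

/-! ### Morphisms from the affine line to a torus -/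

section Rigidity

variable {k B : Type u} [Field k] [CommRing B] [Algebra k B] (A : Subalgebra k B)

/-- The affine line over `K`. -/
noncomputable abbrev line (K : Type u) [Field K] : Over (Spec (.of K)) :=
  Over.mk (Spec.map (CommRingCat.ofHom (Polynomial.C : K →+* Polynomial K)))

/-- The origin of the affine line. -/
noncomputable def origin (K : Type u) [Field K] : Over.mk (𝟙 (Spec (.of K))) ⟶ line K :=
  Over.homMk (Spec.map (CommRingCat.ofHom (Polynomial.evalRingHom (0 : K)))) <| by
    refine (Spec.map_comp _ _).symm.trans ?_
    rw [← CommRingCat.ofHom_comp,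
      show (Polynomial.evalRingHom (0 : K)).comp Polynomial.C = RingHom.id K by ext; simp]
    exact Spec.map_id _

theorem ΓSpecIso_origin (K : Type u) [Field K] (v : globalAlgebra K (line K)) :
    (Scheme.ΓSpecIso (.of K)).hom (globalAlgebraMap K (origin K) v) =
      Polynomial.eval 0 ((Scheme.ΓSpecIso (.of (Polynomial K))).hom v : Polynomial K) :=
  congrArg (fun f => f.hom v)
    (Scheme.ΓSpecIso_naturality (CommRingCat.ofHom (Polynomial.evalRingHom (0 : K))))

/-- Morphisms from the affine line to a torus are constant. -/
theorem splitTorus_line_eq_zero {K : Type u} [Field K] {n : ℕ}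
    (t : (splitTorus K n).obj (.op (line K))) (h : (splitTorus K n).map (origin K).op t = 0) :
    t = 0 := by
  refine splitTorus_ext fun i => ?_
  let φ : globalAlgebra K (line K) →+* Polynomial K :=
    (Scheme.ΓSpecIso (.of (Polynomial K))).hom.hom
  have hφ : Function.Injective φ :=
    (Scheme.ΓSpecIso (.of (Polynomial K))).commRingCatIsoToRingEquiv.injective
  have h0 : Polynomial.eval 0 (φ (torusCoord t i)) = 1 := by
    refine (ΓSpecIso_origin K _).symm.trans ?_
    rw [← torusCoord_map, h]
    exact map_one (Scheme.ΓSpecIso (.of K)).hom.hom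
  -- A unit of `K[X]` is a constant, hence equal to its value `1` at the origin.
  obtain ⟨c, -, hc⟩ := Polynomial.isUnit_iff.mp ((torusCoord t i).isUnit.map φ)
  rw [← hc, Polynomial.eval_C] at h0
  refine hφ (hc.symm.trans ?_)
  rw [h0]
  exact (map_one φ).symm

/-- If the relative unit group is a torus, then `A ⊗ K` contains all nilpotents of `B ⊗ K`. -/
theorem mem_range_of_isNilpotent_of_isTorus (h : IsTorus (relativeUnitGroup A))
    {z : B ⊗[k] AlgebraicClosure k} (hz : IsNilpotent z) :
    z ∈ (tensorInclusion A (AlgebraicClosure k)).range := by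
  obtain ⟨n, ⟨e⟩⟩ := h
  set K := AlgebraicClosure k
  let w : B ⊗[k] Polynomial K :=
    1 + Algebra.TensorProduct.map (AlgHom.id k B) (Polynomial.CAlgHom (R := k) (A := K)) z *
      (1 : B) ⊗ₜ[k] (Polynomial.X : Polynomial K)
  have hw : IsUnit w :=
    ((Commute.all _ _).isNilpotent_mul_right (hz.map _)).isUnit_one_add
  let X := (restrictBase k K).obj (line K)
  let ψ : Polynomial K →+* globalAlgebra k X := (Scheme.ΓSpecIso (.of (Polynomial K))).inv.hom
  have hψ : Function.Injective ψ :=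
    (Scheme.ΓSpecIso (.of (Polynomial K))).symm.commRingCatIsoToRingEquiv.injective
  let α : Polynomial K →ₐ[k] globalAlgebra k X :=
    { ψ with
      commutes' := fun c => by
        refine Eq.trans ?_ (structureHom_restrictBase k K (line K) c).symm
        exact congrArg (fun f => f.hom (algebraMap k K c)) (Scheme.ΓSpecIso_inv_naturality
          (CommRingCat.ofHom (Polynomial.C : K →+* Polynomial K))) }
  have hα0 : globalAlgebraMap k ((restrictBase k K).map (origin K)) (α Polynomial.X) = 0 := by
    refine (Scheme.ΓSpecIso (.of K)).commRingCatIsoToRingEquiv.injective ?_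
    refine Eq.trans ?_ (map_zero (Scheme.ΓSpecIso (.of K)).commRingCatIsoToRingEquiv).symm
    refine (ΓSpecIso_origin K _).trans ?_
    have : (Scheme.ΓSpecIso (.of (Polynomial K))).hom
        ((Scheme.ΓSpecIso (.of (Polynomial K))).inv (Polynomial.X : Polynomial K)) =
        (Polynomial.X : Polynomial K) := Iso.inv_hom_id_apply (Scheme.ΓSpecIso _) _
    exact (congrArg (Polynomial.eval 0) this).trans Polynomial.eval_X
  let s := unitClass A (X := X) (unitsMap B α hw.unit)
  have hs0 : (quotientPresheaf A).map ((restrictBase k K).map (origin K)).op s = 0 := by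
    rw [quotientPresheaf_map_unitClass]
    have : unitsMap B (globalAlgebraMap k ((restrictBase k K).map (origin K)))
        (unitsMap B α hw.unit) = 1 := by
      refine Units.ext ?_
      change Algebra.TensorProduct.map (AlgHom.id k B) (globalAlgebraMap k _)
        (Algebra.TensorProduct.map (AlgHom.id k B) α w) = 1
      simp only [w, map_add, map_one, map_mul, Algebra.TensorProduct.map_tmul, hα0,
        TensorProduct.tmul_zero, mul_zero, add_zero]
    rw [this]
    rfl
  have hs : s = 0 := by
    refine toRelativeUnitGroup_app_injective A s ?_
    -- The section is killed by `η`, by rigidity of the torus; `e` is an isomorphism, so its image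
    -- in the sheaf is zero, and separatedness gives `s = 0`.
    let η : (restrictBase k K).op ⋙ quotientPresheaf A ⟶ splitTorus K n :=
      Functor.whiskerLeft (restrictBase k K).op (toRelativeUnitGroup A) ≫ e.hom
    have h1 : η.app (.op (line K)) s = 0 := by
      refine splitTorus_line_eq_zero _ ?_
      rw [← NatTrans.naturality_apply]
      exact (congrArg _ hs0).trans (map_zero _)
    have h2 : e.hom.app (.op (line K)) ((toRelativeUnitGroup A).app (.op X) s) = 0 := h1
    have h3 := congrArg (e.inv.app (.op (line K))) h2
    rw [map_zero, Iso.hom_inv_id_app_apply] at h3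
    exact h3
  have hmem := ((unitClass_eq_zero_iff A _).mp hs).1
  refine mem_range_of_one_add_mul_X A z ?_
  rw [mem_range_tensorInclusion_iff] at hmem ⊢
  intro l hl
  refine hψ ?_
  rw [map_zero, ← hmem l hl]
  exact (contract_lTensor l α.toLinearMap w).symm

end Rigidity

/-! ### Splitting the quotient by ratios of characters -/

section Splitting

variable {k B K : Type u} [Field k] [CommRing B] [Algebra k B] [Field K] [Algebra k K]
  (A : Subalgebra k B)

/-- The homomorphism `(B ⊗ R)ˣ → (Rˣ)ⁿ` given by the quotients of `n` pairs of characters. -/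
noncomputable def ratioHom {n : ℕ} (χ χ' : Fin n → (B →ₐ[k] K)) (R : Type u) [CommRing R]
    [Algebra k R] [Algebra K R] [IsScalarTower k K R] : (B ⊗[k] R)ˣ →* (Fin n → Rˣ) :=
  MonoidHom.pi fun i => Units.map (evalAt R (χ i) : B ⊗[k] R →* R) /
    Units.map (evalAt R (χ' i) : B ⊗[k] R →* R)

theorem ratioHom_apply {n : ℕ} (χ χ' : Fin n → (B →ₐ[k] K)) (R : Type u) [CommRing R]
    [Algebra k R] [Algebra K R] [IsScalarTower k K R] (u : (B ⊗[k] R)ˣ) (i : Fin n) :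
    ratioHom χ χ' R u i = Units.map (evalAt R (χ i) : B ⊗[k] R →* R) u /
      Units.map (evalAt R (χ' i) : B ⊗[k] R →* R) u := rfl

/-- The pairs are `(χ, r χ)` for the characters with `r χ ≠ χ`. All ratios are `1` exactly when the
values are constant on the classes of `r`, which characterises `A ⊗ R`. -/
theorem exists_ratioHom (hA : ∀ b ∈ nilradical B, b ∈ A)
    [Algebra.Etale k (B ⧸ nilradical B)] [Algebra.Etale k (A ⧸ nilradical A)] [IsAlgClosed K] :
    ∃ (n : ℕ) (χ χ' : Fin n → (B →ₐ[k] K)), ∀ (R : Type u) [CommRing R] [Algebra k R]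
      [Algebra K R] [IsScalarTower k K R], Function.Surjective (ratioHom χ χ' R) ∧
        (ratioHom χ χ' R).ker = (unitsInclusion A R).range := by
  classical
  obtain ⟨_, r, hr, hrA, H⟩ := exists_idempotent_retraction A hA K
  let f := (Fintype.equivFin {χ : B →ₐ[k] K // r χ ≠ χ}).symm
  refine ⟨_, fun i => (f i).1, fun i => r (f i).1, fun R _ _ _ _ => ⟨fun g => ?_, ?_⟩⟩
  -- Prescribing the value `1` at the characters fixed by `r` makes every denominator `1`.
  · obtain ⟨u, hu⟩ := (H R).1 fun χ => if h : r χ ≠ χ then g (f.symm ⟨χ, h⟩) else 1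
    refine ⟨u, funext fun i => ?_⟩
    rw [ratioHom_apply, div_eq_iff_eq_mul]
    refine Units.ext ?_
    refine (hu _).trans ?_
    rw [dif_pos (f i).2, Units.val_mul]
    refine Eq.trans ?_ (congrArg _ (hu _).symm)
    rw [dif_neg (not_not.mpr (hr _))]
    simp
  · ext u
    rw [MonoidHom.mem_ker, mem_range_unitsInclusion_iff]
    have hev (χ) : Units.map (evalAt R χ : B ⊗[k] R →* R) u =
        Units.map (evalAt R (r χ) : B ⊗[k] R →* R) u ↔ evalAt R χ u = evalAt R (r χ) u :=
      Units.ext_iff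
    constructor
    · intro h
      have h1 (χ) : Units.map (evalAt R χ : B ⊗[k] R →* R) u =
          Units.map (evalAt R (r χ) : B ⊗[k] R →* R) u := by
        by_cases hχ : r χ = χ
        · rw [hχ]
        · have := congrFun h (f.symm ⟨χ, hχ⟩)
          rwa [ratioHom_apply, Pi.one_apply, div_eq_one, f.apply_symm_apply] at this
      refine ⟨(H R).2 _ fun χ => (hev χ).mp (h1 χ), (H R).2 _ fun χ => ?_⟩
      exact congrArg (fun v : Rˣ => ((v⁻¹ : Rˣ) : R)) (h1 χ)
    · rintro ⟨⟨a, ha⟩, -⟩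
      refine funext fun i => ?_
      rw [ratioHom_apply, Pi.one_apply, div_eq_one, hev, ← ha]
      refine (evalAt_tensorInclusion A _ a).trans (Eq.trans ?_ (evalAt_tensorInclusion A _ a).symm)
      congr 1
      exact congrArg _ (AlgHom.ext fun a => (hrA _ a a.2).symm)

theorem ratioHom_unitsMap {n : ℕ} (χ χ' : Fin n → (B →ₐ[k] K)) {R S : Type u} [CommRing R]
    [Algebra k R] [Algebra K R] [IsScalarTower k K R] [CommRing S]
    [Algebra k S] [Algebra K S] [IsScalarTower k K S] (φ : R →ₐ[k] S)
    (hφ : ∀ c : K, φ (algebraMap K R c) = algebraMap K S c) (u : (B ⊗[k] R)ˣ) (i : Fin n) :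
    ratioHom χ χ' S (unitsMap B φ u) i = Units.map (φ : R →* S) (ratioHom χ χ' R u i) := by
  rw [ratioHom_apply, ratioHom_apply, map_div]
  congr 1 <;> exact Units.ext (evalAt_map _ φ hφ _)

variable {A}

/-- The homomorphism from the naive quotient to the split torus that is induced by quotients of
characters. -/
noncomputable def ratioApp {n : ℕ} (χ χ' : Fin n → (B →ₐ[k] K))
    (H : ∀ (R : Type u) [CommRing R] [Algebra k R] [Algebra K R] [IsScalarTower k K R],
      (ratioHom χ χ' R).ker = (unitsInclusion A R).range) (X : Over (Spec (.of K))) :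
    (quotientPresheaf A).obj (.op ((restrictBase k K).obj X)) →+
      (splitTorus K n).obj (.op X) :=
  letI := algebraRestrictBase k K X
  haveI := isScalarTower_restrictBase k K X
  let f := QuotientGroup.lift (unitsInclusion A (globalAlgebra k ((restrictBase k K).obj X))).range
    (ratioHom χ χ' (globalAlgebra k ((restrictBase k K).obj X))) (H _).ge
  { toFun := fun x => ULift.up fun i => Additive.ofMul (f x.down.toMul i)
    map_zero' := ULift.ext _ _ (funext fun i =>
      congrArg Additive.ofMul (congrFun (map_one f) i))
    map_add' := fun _ _ => ULift.ext _ _ (funext fun i =>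
      congrArg Additive.ofMul (congrFun (f.map_mul _ _) i)) }

theorem ratioApp_bijective {n : ℕ} (χ χ' : Fin n → (B →ₐ[k] K))
    (H : ∀ (R : Type u) [CommRing R] [Algebra k R] [Algebra K R] [IsScalarTower k K R],
      (ratioHom χ χ' R).ker = (unitsInclusion A R).range)
    (H' : ∀ (R : Type u) [CommRing R] [Algebra k R] [Algebra K R] [IsScalarTower k K R],
      Function.Surjective (ratioHom χ χ' R)) (X : Over (Spec (.of K))) :
    Function.Bijective (ratioApp χ χ' H X) := by
  let _ := algebraRestrictBase k K X
  have := isScalarTower_restrictBase k K X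
  constructor
  · rw [injective_iff_map_eq_zero]
    intro x hx
    obtain ⟨u, rfl⟩ := unitClass_surjective A x
    rw [unitClass_eq_zero_iff', ← H, MonoidHom.mem_ker]
    refine funext fun i => ?_
    exact congrArg (fun t => torusCoord t i) hx
  · intro t
    obtain ⟨u, hu⟩ := H' (globalAlgebra k ((restrictBase k K).obj X)) fun i => torusCoord t i
    refine ⟨unitClass A u, splitTorus_ext fun i => ?_⟩
    exact congrArg Units.val (congrFun hu i)

variable (A)

/-- If `A ⊂ B` have the same nilradical and étale reductions, then the naive quotient on
`K`-schemes is a split torus. -/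
theorem exists_quotientPresheaf_iso (hA : ∀ b ∈ nilradical B, b ∈ A)
    [Algebra.Etale k (B ⧸ nilradical B)] [Algebra.Etale k (A ⧸ nilradical A)] [IsAlgClosed K] :
    ∃ n, Nonempty ((restrictBase k K).op ⋙ quotientPresheaf A ≅ splitTorus K n) := by
  obtain ⟨n, χ, χ', h⟩ := exists_ratioHom (K := K) A hA
  have H (R : Type u) [CommRing R] [Algebra k R] [Algebra K R] [IsScalarTower k K R] :=
    (h R).2
  have H' (R : Type u) [CommRing R] [Algebra k R] [Algebra K R] [IsScalarTower k K R] :=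
    (h R).1
  let θ : (restrictBase k K).op ⋙ quotientPresheaf A ⟶ splitTorus K n :=
    { app := fun X => AddCommGrpCat.ofHom (ratioApp χ χ' H X.unop)
      naturality := fun X Y f => by
        refine AddCommGrpCat.hom_ext (AddMonoidHom.ext fun x => ?_)
        obtain ⟨u, rfl⟩ := unitClass_surjective A x
        refine splitTorus_ext fun i => ?_
        let _ := algebraRestrictBase k K X.unop
        have := isScalarTower_restrictBase k K X.unop
        let _ := algebraRestrictBase k K Y.unop
        have := isScalarTower_restrictBase k K Y.unop
        exact congrArg Units.val (ratioHom_unitsMap χ χ'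
          (globalAlgebraMap k ((restrictBase k K).map f.unop))
          (fun c => appTop_structureHom K f.unop c) u i) }
  have : IsIso θ := by
    rw [NatTrans.isIso_iff_isIso_app]
    intro X
    exact (ConcreteCategory.isIso_iff_bijective _).mpr (ratioApp_bijective χ χ' H H' X.unop)
  exact ⟨n, ⟨asIso θ⟩⟩

/-- If `A ⊂ B` have the same nilradical and étale reductions, then the relative unit group is a
torus. -/
theorem isTorus_relativeUnitGroup (hA : ∀ b ∈ nilradical B, b ∈ A)
    [Algebra.Etale k (B ⧸ nilradical B)] [Algebra.Etale k (A ⧸ nilradical A)] :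
    IsTorus (relativeUnitGroup A) := by
  obtain ⟨n, ⟨i⟩⟩ := exists_quotientPresheaf_iso (K := AlgebraicClosure k) A hA
  let F := restrictBase k (AlgebraicClosure k)
  let J := Scheme.fppfTopology.{u}.over (Spec (.of (AlgebraicClosure k)))
  let J' := Scheme.fppfTopology.{u}.over (Spec (.of k))
  let P : Sheaf J AddCommGrpCat.{u + 1} :=
    ⟨F.op ⋙ quotientPresheaf A, (Presheaf.isSheaf_of_iso_iff i).mpr (isSheaf_splitTorus _ n)⟩
  let G : Sheaf J AddCommGrpCat.{u + 1} :=
    ⟨F.op ⋙ (relativeUnitGroup A).obj, F.op_comp_isSheaf J J' (relativeUnitGroup A)⟩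
  let η : P ⟶ G := ⟨Functor.whiskerLeft F.op (toRelativeUnitGroup A)⟩
  -- Restriction along `F` keeps the sheafification map locally bijective, and a locally bijective
  -- map of sheaves is an isomorphism; the source is a sheaf because it is isomorphic to a split
  -- torus.
  have : IsIso η := (Sheaf.isLocallyBijective_iff_isIso η).mp
    ⟨Presheaf.isLocallyInjective_whisker J J' F (toRelativeUnitGroup A),
      Presheaf.isLocallySurjective_whisker J J' F (toRelativeUnitGroup A)⟩
  exact ⟨n, ⟨(asIso ((sheafToPresheaf _ _).map η)).symm ≪≫ i⟩⟩

end Splitting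

end RelativeUnits

/-! ### The main theorem -/

open RelativeUnits

theorem mainTheorem4 {k B : Type u} [Field k] [CommRing B] [Algebra k B] [Module.Finite k B]
    (A : Subalgebra k B) :
    (RelativeUnits.IsTorus (RelativeUnits.relativeUnitGroup A) →
      Subtype.val '' (nilradical A : Set A) = (nilradical B : Set B)) ∧
    (Subtype.val '' (nilradical A : Set A) = (nilradical B : Set B) ∧
        Algebra.Etale k (B ⧸ nilradical B) →
      RelativeUnits.IsTorus (RelativeUnits.relativeUnitGroup A) ∧
        Algebra.Etale k (A ⧸ nilradical A)) ∧
    ((∀ 𝔞 : Ideal B, (𝔞 : Set B) ⊆ (A : Set B) → IsNilpotent 𝔞) →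
      (RelativeUnits.IsTorus (RelativeUnits.relativeUnitGroup A) ↔
        Subtype.val '' (nilradical A : Set A) = (nilradical B : Set B) ∧
          Algebra.Etale k (B ⧸ nilradical B))) := by
  have hnil (a : A) : a ∈ nilradical A ↔ (a : B) ∈ nilradical B := by
    rw [mem_nilradical, mem_nilradical]
    exact (IsNilpotent.map_iff (f := A.val) Subtype.val_injective).symm
  have ha (h : IsTorus (relativeUnitGroup A)) :
      Subtype.val '' (nilradical A : Set A) = (nilradical B : Set B) := by
    ext b
    constructor
    · rintro ⟨a, ha, rfl⟩
      exact (hnil a).mp ha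
    · intro hb
      have hbA : b ∈ A := (tmul_one_mem_range_iff (R := AlgebraicClosure k) A b).mp
        (mem_range_of_isNilpotent_of_isTorus A h
          ((mem_nilradical.mp hb).map (Algebra.TensorProduct.includeLeft :
            B →ₐ[k] B ⊗[k] AlgebraicClosure k)))
      exact ⟨⟨b, hbA⟩, (hnil ⟨b, hbA⟩).mpr hb, rfl⟩
  have hb (h : Subtype.val '' (nilradical A : Set A) = (nilradical B : Set B) ∧
      Algebra.Etale k (B ⧸ nilradical B)) : IsTorus (relativeUnitGroup A) ∧
        Algebra.Etale k (A ⧸ nilradical A) := by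
    obtain ⟨hI, hB⟩ := h
    -- The nilradical of `A` is the preimage of that of `B`, so `A_red → B_red` is injective.
    have hker : nilradical A = (nilradical B).comap A.val := Ideal.ext hnil
    have hA : Algebra.Etale k (A ⧸ nilradical A) := etale_of_injective
      (Ideal.quotientMapₐ (nilradical B) A.val hker.le) (Ideal.quotientMap_injective' (H := hker.le) hker.ge)
    refine ⟨isTorus_relativeUnitGroup A fun b hb => ?_, hA⟩
    obtain ⟨a, -, rfl⟩ := hI.ge hb
    exact a.2
  refine ⟨ha, hb, fun hc => ⟨fun h => ⟨ha h, ?_⟩, fun h => (hb h).1⟩⟩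
  rw [etale_iff_isReduced]
  refine isReduced_tensorProduct_quotient fun z hz => mem_range_nilradical_of_isNilpotent A
    (fun z hz => mem_range_of_isNilpotent_of_isTorus A h hz) (fun b hb => ?_) hz
  -- The conductor is itself an ideal of `B` inside `A`, so the hypothesis makes it nilpotent.
  obtain ⟨n, hn⟩ := hc _ (conductorIdeal_subset A)
  exact ⟨n, by simpa [hn] using Ideal.pow_mem_pow hb n⟩
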